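/- Let $\mathbb F_q$ be a finite field of odd characteristic. For $n\ge 0$ let $[\pm n]=\{\pm1,\dots,\pm n\}$ be ordered by $1\prec\cdots\prec n\prec -n\prec\cdots\prec -1$; rows and columns of $2n\times 2n$ matrices are indexed by $[\pm n]$ in this order. Let $U_m(q)$ be the group of $m\times m$ unipotent upper triangular matrices over $\mathbb F_q$, and let $$U^D_{2n}(q)=\left\{\begin{pmatrix}P&PQ\\0&JP^{-t}J\end{pmatrix}: P\in U_n(q),\ Q\in M_n(\mathbb F_q),\ JQ^tJ=-Q\right\},$$ where $J$ is the $n\times n$ matrix with ones on the antidiagonal and zeros elsewhere. A $D_{2n}(q)$-partition $\lambda$ is a finite set of labelled arcs $(i,j,a)$ with $i\prec j$ in $[\pm n]$, $j\ne -i$, $a\in\mathbb F_q\setminus\{0\}$, at most one label for each pair $(i,j)$, such that (a) $(i,j,a)\in\lambda$ implies $(-j,-i,-a)\in\lambda$, and (b) if $(i,j,a)\in\lambda$ and $i\prec k\prec j$, then $(i,k,b)\notin\lambda$ and $(k,j,b)\notin\lambda$ for all $b$. Put $y_\lambda=\sum_{(i,j,a)\in\lambda}a\,e_{i,j}$. The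 superclass of $\lambda$ is $K_\lambda=U^D_{2n}(q)\cap\bigl(I_{2n}+U_{2n}(q)\,y_\lambda\,U_{2n}(q)\bigr)$, and $\kappa_\lambda:U^D_{2n}(q)\to\mathbb C$ is its characteristic function. Let $\mathbf{SC}^D_{2n}$ be the space of functions $U^D_{2n}(q)\to\mathbb C$ that are constant on every superclass, and $\mathbf{SC}^D=\bigoplus_{n\ge0}\mathbf{SC}^D_{2n}$. For $A\subseteq[n]$ let $A^c=[n]\setminus A$ and $\pm A=A\cup -A$, and let $\mathrm{st}_A:\pm A\to[\pm|A|]$ be the order-preserving bijection. For $J=(A\,|\,A^c)$ let $U^D_J$ be the set of $x\in U^D_{2n}(q)$ such that $x_{ij}\neq0$ only if $i,j$ both lie in $\pm A$ or both lie in $\pm A^c$. Reordering rows and columns by $\mathrm{st}_A$ and $\mathrm{st}_{A^c}$ gives a bijection $\mathrm{st}_J:U_J^D\to U^D_{2|A|}(q)\times U^D_{2|A^c|}(q)$. Let $$\mathrm{Res}_J:\mathbf{SC}^D_{2n}\to\mathbf{SC}^D_{2|A|}\otimes\mathbf{SC}^D_{2|A^c|},\qquad \mathrm{Res}_J(\chi)(u)=\chi(\mathrm{st}_J^{-1}(u)),$$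 where a tensor $\alpha\otimes\beta$ is identified with the function $(u,v)\mapsto\alpha(u)\beta(v)$. Let $\Delta:\mathbf{SC}^D\to\mathbf{SC}^D\otimes\mathbf{SC}^D$ be the linear map with $\Delta(\chi)=\sum_{J}\mathrm{Res}_J(\chi)$ for $\chi\in\mathbf{SC}^D_{2n}$, summed over all $J=(A\,|\,A^c)$ with $A\subseteq[n]$ (including $A=\emptyset$ and $A=[n]$). For a $D_{2n}(q)$-partition $\lambda$ let $\lambda|_A$ be the set of arcs of $\lambda$ with both ends in $\pm A$, and let $\mathrm{st}_A(\lambda|_A)$ be the $D_{2|A|}(q)$-partition obtained by relabelling the ends of its arcs by $\mathrm{st}_A$. Write $\lambda=\lambda|_A\sqcup\lambda|_{A^c}$ if every arc of $\lambda$ lies in $\lambda|_A$ or in $\lambda|_{A^c}$. **Proposition.** For every $n\ge 0$ and every $D_{2n}(q)$-partition $\lambda$, $$\Delta(\kappa_\lambda)=\sum_{\substack{A\subseteq[n]\\ \lambda=\lambda|_A\sqcup\lambda|_{A^c}}}\kappa_{\mathrm{st}_A(\lambda|_A)}\otimes\kappa_{\mathrm{st}_{A^c}(\lambda|_{A^c})}.$$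 -/

import Mathlib

open scoped TensorProduct DirectSum

noncomputable section

namespace TypeD

/-! The ground set `[±n]` with the total order `1 ≺ ⋯ ≺ n ≺ -n ≺ ⋯ ≺ -1`. -/

/-- The ordered set `[±n]`: a copy of `Fin n` (the elements `1 ≺ ⋯ ≺ n`) followed by a reversed
copy of `Fin n` (the elements `-n ≺ ⋯ ≺ -1`). -/
abbrev PM (n : ℕ) : Type := Fin n ⊕ₗ (Fin n)ᵒᵈ

/-- The map `i ↦ |i|` from `[±n]` to `[n]`. -/
def absv {n : ℕ} (s : PM n) : Fin n :=
  Sum.elim id OrderDual.ofDual (ofLex s)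

/-- The map `i ↦ -i` on `[±n]`. -/
def opp {n : ℕ} (s : PM n) : PM n :=
  toLex (Sum.elim (fun i => Sum.inr (OrderDual.toDual i)) (fun i => Sum.inl (OrderDual.ofDual i))
    (ofLex s))

/-- The block (left or right) and the position inside it of an element of `[±n]`: `i` sits at
position `i` of the first block, and `-i` at position `n + 1 - i` of the second one. -/
def place {n : ℕ} (s : PM n) : Fin n ⊕ Fin n :=
  Sum.map id (fun i => Fin.rev (OrderDual.ofDual i)) (ofLex s)

/-- The inverse `[±|A|] → ±A ⊆ [±n]` of the standardization map `st_A`: the order preserving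
bijection from `[|A|]` onto `A`, applied to absolute values. -/
def unst {n : ℕ} (A : Finset (Fin n)) (s : PM A.card) : PM n :=
  toLex (Sum.map (A.orderEmbOfFin rfl)
    (fun i => OrderDual.toDual (A.orderEmbOfFin rfl (OrderDual.ofDual i))) (ofLex s))

/-! The groups. -/

/-- The group of unipotent upper triangular matrices. -/
def Uni (ι F : Type*) [LinearOrder ι] [Field F] : Set (Matrix ι ι F) :=
  {g | (∀ i, g i i = 1) ∧ ∀ i j, j < i → g i j = 0}

/-- The matrix with ones on the antidiagonal and zeros elsewhere. -/
def antidiag (n : ℕ) (F : Type*) [Field F] : Matrix (Fin n) (Fin n) F :=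
  Matrix.of fun i j => if j = Fin.rev i then 1 else 0

/-- The even orthogonal unipotent upper triangular matrices, i.e. the matrices
`(P, PQ; 0, J P⁻ᵗ J)` with `P` unipotent upper triangular and `J Qᵗ J = -Q`. The rows and columns
are labelled by `[±n]` in increasing order. -/
def UD (n : ℕ) (F : Type*) [Field F] : Set (Matrix (PM n) (PM n) F) :=
  {x | ∃ P ∈ Uni (Fin n) F, ∃ Q : Matrix (Fin n) (Fin n) F,
    antidiag n F * Q.transpose * antidiag n F = -Q ∧
    x = (Matrix.fromBlocks P (P * Q) 0
      (antidiag n F * P⁻¹.transpose * antidiag n F)).submatrix place place}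

/-! Labelled set partitions of type D. -/

/-- A `D_{2n}(q)`-partition: a finite set of labelled arcs `(i, j, a)`, with `i ≺ j` in `[±n]`,
`j ≠ -i` and `a ≠ 0`. An arc carries only one label. -/
@[ext] structure DPartition (n : ℕ) (F : Type*) [Field F] where
  arcs : Finset (PM n × PM n × F)
  lt : ∀ i j a, (i, j, a) ∈ arcs → i < j
  ne_opp : ∀ i j a, (i, j, a) ∈ arcs → j ≠ opp i
  ne_zero : ∀ i j a, (i, j, a) ∈ arcs → a ≠ 0
  label : ∀ i j a b, (i, j, a) ∈ arcs → (i, j, b) ∈ arcs → a = b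
  symm : ∀ i j a, (i, j, a) ∈ arcs → (opp j, opp i, -a) ∈ arcs
  short : ∀ i j a, (i, j, a) ∈ arcs → ∀ k, i < k → k < j → ∀ b,
    (i, k, b) ∉ arcs ∧ (k, j, b) ∉ arcs

end TypeD

namespace TypeD

/-! Order facts about `[±n]`. -/

section order
variable {n : ℕ}

theorem opp_opp (s : PM n) : opp (opp s) = s := by
  induction s using Lex.rec with | _ s => rcases s with i | i <;> rfl

set_option linter.unusedSimpArgs false in
theorem opp_lt (s t : PM n) : opp s < opp t ↔ t < s := by
  induction s using Lex.rec with | _ s =>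
  induction t using Lex.rec with | _ t =>
  rcases s with i | i <;> rcases t with j | j <;>
    simp [opp, Sum.Lex.inl_lt_inl_iff, Sum.Lex.inr_lt_inr_iff, Sum.Lex.inl_lt_inr,
      Sum.Lex.not_inr_lt_inl]

theorem absv_opp (s : PM n) : absv (opp s) = absv s := by
  induction s using Lex.rec with | _ s => rcases s with i | i <;> rfl

set_option linter.unusedSimpArgs false in
theorem unst_lt (A : Finset (Fin n)) (s t : PM A.card) : unst A s < unst A t ↔ s < t := by
  induction s using Lex.rec with | _ s =>
  induction t using Lex.rec with | _ t =>
  rcases s with i | i <;> rcases t with j | j <;>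
    simp [unst, Sum.Lex.inl_lt_inl_iff, Sum.Lex.inr_lt_inr_iff, Sum.Lex.inl_lt_inr,
      Sum.Lex.not_inr_lt_inl]

theorem unst_inj (A : Finset (Fin n)) : Function.Injective (unst A) :=
  StrictMono.injective fun s t h => (unst_lt A s t).2 h

theorem unst_opp (A : Finset (Fin n)) (s : PM A.card) : unst A (opp s) = opp (unst A s) := by
  induction s using Lex.rec with | _ s => rcases s with i | i <;> rfl

theorem absv_unst (A : Finset (Fin n)) (s : PM A.card) : absv (unst A s) ∈ A := by
  induction s using Lex.rec with | _ s => rcases s with i | i <;> simp [absv, unst]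

theorem exists_unst (A : Finset (Fin n)) (s : PM n) (h : absv s ∈ A) : ∃ t, unst A t = s := by
  have hA : Set.range (A.orderEmbOfFin rfl) = A := Finset.range_orderEmbOfFin A rfl
  induction s using Lex.rec with | _ s =>
  rcases s with i | i
  · obtain ⟨t, ht⟩ : i ∈ Set.range (A.orderEmbOfFin rfl) := by rw [hA]; exact h
    exact ⟨toLex (Sum.inl t), by simp [unst, ht]⟩
  · obtain ⟨t, ht⟩ : OrderDual.ofDual i ∈ Set.range (A.orderEmbOfFin rfl) := by rw [hA]; exact h
    exact ⟨toLex (Sum.inr (OrderDual.toDual t)), by simp [unst, ht]⟩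

theorem bij_unst (A : Finset (Fin n)) :
    Function.Bijective (Sum.elim (unst A) (unst Aᶜ)) := by
  refine ⟨(unst_inj A).sumElim (unst_inj Aᶜ) ?_, fun s => ?_⟩
  · intro a b h
    have h1 := absv_unst A a
    have h2 := absv_unst Aᶜ b
    rw [h] at h1
    exact (Finset.mem_compl.1 h2) h1
  · by_cases h : absv s ∈ A
    · obtain ⟨t, ht⟩ := exists_unst A s h
      exact ⟨Sum.inl t, ht⟩
    · obtain ⟨t, ht⟩ := exists_unst Aᶜ s (Finset.mem_compl.2 h)
      exact ⟨Sum.inr t, ht⟩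

/-- `[±n]` is the disjoint union of `±A` and `±Aᶜ`. -/
def glue (A : Finset (Fin n)) : PM A.card ⊕ PM Aᶜ.card ≃ PM n :=
  Equiv.ofBijective _ (bij_unst A)

end order

/-! Unipotent upper triangular matrices: group properties and two-sided orbits. -/

section orbits
variable {ι F : Type*} [LinearOrder ι] [Fintype ι] [Field F]

theorem uni_one : (1 : Matrix ι ι F) ∈ Uni ι F :=
  ⟨fun i => by simp, fun i j h => by simp [h.ne']⟩

theorem uni_mul {g h : Matrix ι ι F} (hg : g ∈ Uni ι F) (hh : h ∈ Uni ι F) : g * h ∈ Uni ι F := by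
  refine ⟨fun i => ?_, fun i j hij => ?_⟩
  · rw [Matrix.mul_apply, Finset.sum_eq_single i]
    · simp [hg.1, hh.1]
    · intro k _ hk
      rcases lt_or_gt_of_ne hk with hk | hk
      · simp [hg.2 i k hk]
      · simp [hh.2 k i hk]
    · simp
  · rw [Matrix.mul_apply]
    refine Finset.sum_eq_zero fun k _ => ?_
    rcases lt_or_ge k i with hk | hk
    · simp [hg.2 i k hk]
    · simp [hh.2 k j (hij.trans_le hk)]

theorem uni_det {g : Matrix ι ι F} (hg : g ∈ Uni ι F) : g.det = 1 := by
  rw [Matrix.det_of_isUpperTriangular (fun i j h => hg.2 i j h)]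
  simp [hg.1]

theorem uni_isUnit {g : Matrix ι ι F} (hg : g ∈ Uni ι F) : IsUnit g.det := by
  simp [uni_det hg]

theorem uni_inv {g : Matrix ι ι F} (hg : g ∈ Uni ι F) : g⁻¹ ∈ Uni ι F := by
  have hu := uni_isUnit hg
  have hT : Matrix.BlockTriangular g⁻¹ id := by
    have := Matrix.invertibleOfIsUnitDet g hu
    exact Matrix.blockTriangular_inv_of_blockTriangular (fun i j h => hg.2 i j h)
  refine ⟨fun i => ?_, fun i j hij => hT hij⟩
  have h1 : (g⁻¹ * g) i i = 1 := by rw [Matrix.nonsing_inv_mul g hu]; simp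
  rw [Matrix.mul_apply, Finset.sum_eq_single i] at h1
  · simpa [hg.1] using h1
  · intro k _ hk
    rcases lt_or_gt_of_ne hk with hk | hk
    · rw [show g⁻¹ i k = 0 from hT hk, zero_mul]
    · simp [hg.2 k i hk]
  · simp

/-- The two-sided orbit of `y` under the group of unipotent upper triangular matrices. -/
def orbit (y : Matrix ι ι F) : Set (Matrix ι ι F) :=
  {z | ∃ g ∈ Uni ι F, ∃ h ∈ Uni ι F, z = g * y * h}

theorem orbit_refl (y : Matrix ι ι F) : y ∈ orbit y := ⟨1, uni_one, 1, uni_one, by simp⟩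

theorem orbit_symm {y z : Matrix ι ι F} (h : z ∈ orbit y) : y ∈ orbit z := by
  obtain ⟨g, hg, k, hk, rfl⟩ := h
  refine ⟨g⁻¹, uni_inv hg, k⁻¹, uni_inv hk, ?_⟩
  rw [Matrix.mul_assoc g, Matrix.nonsing_inv_mul_cancel_left _ _ (uni_isUnit hg),
    Matrix.mul_nonsing_inv_cancel_right _ _ (uni_isUnit hk)]

theorem orbit_trans {x y z : Matrix ι ι F} (h : y ∈ orbit x) (h' : z ∈ orbit y) :
    z ∈ orbit x := by
  obtain ⟨g, hg, k, hk, rfl⟩ := h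
  obtain ⟨g', hg', k', hk', rfl⟩ := h'
  exact ⟨g' * g, uni_mul hg' hg, k * k', uni_mul hk hk', by simp only [Matrix.mul_assoc]⟩

/-- At most one nonzero entry in every row and column. -/
def Partial (y : Matrix ι ι F) : Prop :=
  (∀ i j k, y i j ≠ 0 → y i k ≠ 0 → j = k) ∧ ∀ i j k, y i k ≠ 0 → y j k ≠ 0 → i = j

theorem partial_le {y y' : Matrix ι ι F} (hy : Partial y) (hy' : Partial y')
    {g k : Matrix ι ι F} (hg : g ∈ Uni ι F) (hk : k ∈ Uni ι F) (e : g * y = y' * k)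
    (i j : ι) (h : y i j ≠ 0) : ∃ c ≤ j, y' i c ≠ 0 ∧ y' i c * k c j = y i j := by
  have e1 : (g * y) i j = y i j := by
    rw [Matrix.mul_apply, Finset.sum_eq_single i]
    · simp [hg.1]
    · intro r _ hr
      by_contra h0
      exact hr (hy.2 r i j (right_ne_zero_of_mul h0) h)
    · simp
  rw [e, Matrix.mul_apply] at e1
  obtain ⟨c, -, hc⟩ := Finset.exists_ne_zero_of_sum_ne_zero (e1.trans_ne h)
  refine ⟨c, ?_, left_ne_zero_of_mul hc, ?_⟩
  · by_contra hcj
    exact right_ne_zero_of_mul hc (hk.2 c j (not_le.1 hcj))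
  · rw [← e1, Finset.sum_eq_single c]
    · intro r _ hr
      by_contra h0
      exact hr (hy'.1 i r c (left_ne_zero_of_mul h0) (left_ne_zero_of_mul hc))
    · simp

theorem partial_entry {y y' : Matrix ι ι F} (hy : Partial y) (hy' : Partial y')
    (h : y' ∈ orbit y) (i j : ι) (hij : y i j ≠ 0) : y' i j = y i j := by
  have key : ∀ {y y' : Matrix ι ι F}, y' ∈ orbit y →
      ∃ g ∈ Uni ι F, ∃ k ∈ Uni ι F, g * y = y' * k := by
    rintro y _ ⟨g, hg, k, hk, rfl⟩
    exact ⟨g, hg, k⁻¹, uni_inv hk, by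
      rw [Matrix.mul_nonsing_inv_cancel_right _ _ (uni_isUnit hk)]⟩
  obtain ⟨g, hg, k, hk, e⟩ := key h
  obtain ⟨g', hg', k', hk', e'⟩ := key (orbit_symm h)
  obtain ⟨c, hc, hc0, hce⟩ := partial_le hy hy' hg hk e i j hij
  obtain ⟨d, hd, hd0, -⟩ := partial_le hy' hy hg' hk' e' i c hc0
  have hdj : d = j := hy.1 i d j hd0 hij
  have : c = j := le_antisymm hc (hdj ▸ hd)
  subst this
  rw [← hce, hk.1, mul_one]

theorem partial_unique {y y' : Matrix ι ι F} (hy : Partial y) (hy' : Partial y')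
    (h : y' ∈ orbit y) : y' = y := by
  ext i j
  by_cases h0 : y i j = 0
  · by_contra h1
    exact h1 (partial_entry hy' hy (orbit_symm h) i j (fun h2 => h1 (h2.trans h0.symm))).symm
  · exact partial_entry hy hy' h i j h0

theorem exists_partial_aux (z : Matrix ι ι F) (D : Finset ι) :
    IsUpperSet (D : Set ι) → ∃ y ∈ orbit z,
      ∀ r ∈ D, ∀ j, y r j ≠ 0 → (∀ k, k ≠ j → y r k = 0) ∧ ∀ s, s ≠ r → y s j = 0 := by
  induction D using Finset.induction_on_min with
  | empty => exact fun _ => ⟨z, orbit_refl z, by simp⟩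
  | insert i D hi ih =>
    intro hD
    have hD' : IsUpperSet (D : Set ι) := by
      intro a b hab ha
      have := hD hab (by simp [show a ∈ D from ha])
      rcases Finset.mem_insert.1 (Finset.mem_coe.1 this) with h | h
      · exact absurd (hi a ha) (not_lt.2 (h ▸ hab))
      · exact h
    have hgt : ∀ s, s ∉ D → s ≠ i → s < i := by
      intro s hs hsi
      by_contra hlt
      have := hD (not_lt.1 hlt) (by simp)
      rcases Finset.mem_insert.1 (Finset.mem_coe.1 this) with h | h
      · exact hsi h
      · exact hs h
    have hiD : i ∉ D := fun h => lt_irrefl _ (hi i h)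
    obtain ⟨M, hM, hMD⟩ := ih hD'
    by_cases hrow : ∀ j, M i j = 0
    · refine ⟨M, hM, fun r hr j hj => ?_⟩
      rcases Finset.mem_insert.1 hr with rfl | hr
      · exact absurd (hrow j) hj
      · exact hMD r hr j hj
    push Not at hrow
    classical
    obtain ⟨j, hj, hmin⟩ : ∃ j, M i j ≠ 0 ∧ ∀ k < j, M i k = 0 := by
      obtain ⟨j, hj⟩ := (Finset.univ.filter fun j => M i j ≠ 0).exists_minimal
        (by obtain ⟨j, hj⟩ := hrow; exact ⟨j, by simpa using hj⟩)
      refine ⟨j, by simpa using hj.1, fun k hk => ?_⟩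
      by_contra h
      exact not_le.2 hk (hj.2 (by simpa using h) hk.le)
    have hDj : ∀ r ∈ D, M r j = 0 := by
      intro r hr
      by_contra h
      exact hj ((hMD r hr j h).2 i (fun h => hiD (h ▸ hr)))
    let u : ι → F := fun r => if r < i then M r j / M i j else 0
    let v : ι → F := fun k => if j < k then M i k / M i j else 0
    let g : Matrix ι ι F := 1 - Matrix.of fun r s => if s = i then u r else 0
    let h : Matrix ι ι F := 1 - Matrix.of fun s k => if s = j then v k else 0
    have hg : g ∈ Uni ι F := by
      refine ⟨fun r => ?_, fun r s hrs => ?_⟩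
      · by_cases hr : r = i <;> simp [g, u, hr]
      · by_cases hs : s = i
        · subst hs; simp [g, u, hrs.ne', not_lt.2 hrs.le]
        · simp [g, hs, hrs.ne']
    have hh : h ∈ Uni ι F := by
      refine ⟨fun r => ?_, fun r s hrs => ?_⟩
      · by_cases hr : r = j <;> simp [h, v, hr]
      · by_cases hs : r = j
        · subst hs; simp [h, v, hrs.ne', not_lt.2 hrs.le]
        · simp [h, hs, hrs.ne']
    have hgM : ∀ (N : Matrix ι ι F) r k, (g * N) r k = N r k - u r * N i k := by
      intro N r k
      simp [g, Matrix.mul_apply, sub_mul, Finset.sum_sub_distrib, Matrix.one_apply]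
    have hMh : ∀ (N : Matrix ι ι F) r k, (N * h) r k = N r k - N r j * v k := by
      intro N r k
      simp [h, Matrix.mul_apply, mul_sub, Finset.sum_sub_distrib, Matrix.one_apply]
    have hi1 : ∀ k, k ≠ j → M i k - M i j * v k = 0 := by
      intro k hk
      rcases lt_or_gt_of_ne hk with hk | hk
      · simp [v, hmin k hk, not_lt.2 hk.le]
      · simp [v, hk]; field_simp; ring
    have hvj : v j = 0 := by simp [v]
    have hui : u i = 0 := by simp [u]
    have huD : ∀ r ∈ D, u r = 0 := fun r hr => by simp [u, not_lt.2 (hi r hr).le]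
    have hcol : ∀ r, r ≠ i → M r j - u r * M i j = 0 := by
      intro r hr
      by_cases hrD : r ∈ D
      · simp [huD r hrD, hDj r hrD]
      · simp [u, hgt r hrD hr]; field_simp; ring
    have ent : ∀ r k, (g * M * h) r k
        = (M r k - u r * M i k) - (M r j - u r * M i j) * v k := by
      intro r k
      rw [hMh, hgM, hgM]
    refine ⟨g * M * h, orbit_trans hM ⟨g, hg, h, hh, rfl⟩, fun r hr k hk => ?_⟩
    have enti : ∀ k, k ≠ j → (g * M * h) i k = 0 := by
      intro k hk
      rw [ent, hui]; simpa using hi1 k hk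
    rcases Finset.mem_insert.1 hr with rfl | hrD
    · have hkj : k = j := by
        by_contra h
        exact hk (enti k h)
      subst hkj
      refine ⟨enti, fun s hs => ?_⟩
      rw [ent, hcol s hs]; simp
    · have entr : ∀ k, (g * M * h) r k = M r k := by
        intro k
        rw [ent, huD r hrD, hDj r hrD]; simp
      rw [entr] at hk
      obtain ⟨h1, h2⟩ := hMD r hrD k hk
      refine ⟨fun k' hk' => by rw [entr, h1 k' hk'], fun s hs => ?_⟩
      have hik : M i k = 0 := h2 i (fun h => hiD (h ▸ hrD))
      have hvk : v k = 0 := by simp [v, hik]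
      rw [ent, h2 s hs, hik, hvk]; simp

theorem exists_partial (z : Matrix ι ι F) : ∃ y ∈ orbit z, Partial y := by
  obtain ⟨y, hy, h⟩ := exists_partial_aux z Finset.univ (by simp [isUpperSet_univ])
  refine ⟨y, hy, fun i j k hj hk => ?_, fun i j k hi hj => ?_⟩
  · by_contra hne
    exact hk ((h i (by simp) j hj).1 k (Ne.symm hne))
  · by_contra hne
    exact hj ((h i (by simp) k hi).2 j (Ne.symm hne))

end orbits
end TypeD

namespace TypeD

section group
variable {n : ℕ} {F : Type*} [Field F]

/-- The adjoint of a matrix for the split symmetric bilinear form pairing `i` with `-i`. -/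
def adj (x : Matrix (PM n) (PM n) F) : Matrix (PM n) (PM n) F :=
  x.transpose.submatrix opp opp

theorem adj_apply (x : Matrix (PM n) (PM n) F) (i j : PM n) : adj x i j = x (opp j) (opp i) := rfl

theorem adj_mul (x y : Matrix (PM n) (PM n) F) : adj (x * y) = adj y * adj x := by
  let e : PM n ≃ PM n := ⟨opp, opp, opp_opp, opp_opp⟩
  have : ∀ z : Matrix (PM n) (PM n) F, adj z = z.transpose.submatrix e e := fun z => rfl
  rw [this, this, this, Matrix.transpose_mul, Matrix.submatrix_mul_equiv]

theorem adj_one : adj (1 : Matrix (PM n) (PM n) F) = 1 := by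
  let e : PM n ≃ PM n := ⟨opp, opp, opp_opp, opp_opp⟩
  change (1 : Matrix (PM n) (PM n) F).transpose.submatrix e e = 1
  simp

theorem adj_uni {x : Matrix (PM n) (PM n) F} (hx : x ∈ Uni (PM n) F) : adj x ∈ Uni (PM n) F :=
  ⟨fun i => hx.1 _, fun i j h => hx.2 _ _ ((opp_lt _ _).2 h)⟩

/-- The labels of the rows and columns, first the positive and then the negative ones. -/
def lab : Fin n ⊕ Fin n ≃ PM n :=
  (Equiv.sumCongr (Equiv.refl _) OrderDual.toDual).trans toLex

theorem lab_inl_lt (i j : Fin n) : (lab (Sum.inl i) : PM n) < lab (Sum.inl j) ↔ i < j :=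
  Sum.Lex.inl_lt_inl_iff

theorem lab_inr_lt (i j : Fin n) : (lab (Sum.inr i) : PM n) < lab (Sum.inr j) ↔ j < i :=
  Sum.Lex.inr_lt_inr_iff

theorem lab_lt (i j : Fin n) : (lab (Sum.inl i) : PM n) < lab (Sum.inr j) :=
  Sum.Lex.inl_lt_inr _ _

theorem antidiag_conj (M : Matrix (Fin n) (Fin n) F) (i j : Fin n) :
    (antidiag n F * M * antidiag n F) i j = M i.rev j.rev := by
  have h : ∀ k : Fin n, (j = Fin.rev k) ↔ (k = Fin.rev j) := fun k =>
    ⟨fun h => by rw [h, Fin.rev_rev], fun h => by rw [h, Fin.rev_rev]⟩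
  simp [antidiag, Matrix.mul_apply, h]

theorem fromBlocks_lab (P Q : Matrix (Fin n) (Fin n) F) :
    ((Matrix.fromBlocks P (P * Q) 0 (antidiag n F * P⁻¹.transpose * antidiag n F)).submatrix
      place place : Matrix (PM n) (PM n) F).submatrix lab lab =
    Matrix.fromBlocks P (P * Q.submatrix id Fin.rev) 0 P⁻¹.transpose := by
  ext i j
  rcases i with i | i <;> rcases j with j | j
  · rfl
  · rfl
  · rfl
  · change (antidiag n F * P⁻¹.transpose * antidiag n F) i.rev j.rev = _
    rw [antidiag_conj, Fin.rev_rev, Fin.rev_rev]; rfl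

theorem adj_lab (A B C D : Matrix (Fin n) (Fin n) F) (x : Matrix (PM n) (PM n) F)
    (hx : x.submatrix lab lab = Matrix.fromBlocks A B C D) :
    (adj x).submatrix lab lab =
      Matrix.fromBlocks D.transpose B.transpose C.transpose A.transpose := by
  have h : ∀ i j, x (lab i) (lab j) = Matrix.fromBlocks A B C D i j := fun i j => by
    rw [← hx]; rfl
  ext i j
  rcases i with i | i <;> rcases j with j | j
  · exact h (Sum.inr j) (Sum.inr i)
  · exact h (Sum.inl j) (Sum.inr i)
  · exact h (Sum.inr j) (Sum.inl i)
  · exact h (Sum.inl j) (Sum.inl i)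

theorem skew_iff (Q : Matrix (Fin n) (Fin n) F) :
    antidiag n F * Q.transpose * antidiag n F = -Q ↔
      (Q.submatrix id Fin.rev).transpose = -(Q.submatrix id Fin.rev) := by
  constructor
  · intro h
    ext i j
    have := congrFun (congrFun h i) j.rev
    rw [antidiag_conj, Fin.rev_rev] at this
    simpa using this
  · intro h
    ext i j
    have := congrFun (congrFun h i) j.rev
    rw [antidiag_conj]
    simpa using this

/-- The group of type D consists of the unipotent upper triangular isometries of the form. -/
theorem mem_UD_iff (x : Matrix (PM n) (PM n) F) :
    x ∈ UD n F ↔ x ∈ Uni (PM n) F ∧ x * adj x = 1 := by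
  have mul1 : x * adj x = 1 ↔
      x.submatrix lab lab * (adj x).submatrix lab lab = 1 := by
    rw [Matrix.submatrix_mul_equiv]
    constructor
    · intro h; rw [h, Matrix.submatrix_one_equiv]
    · intro h
      have := congrArg (fun m => m.submatrix lab.symm lab.symm) h
      simpa using this
  constructor
  · rintro ⟨P, hP, Q, hQ, e⟩
    have hx := fromBlocks_lab P Q
    rw [← e] at hx
    have hu := uni_isUnit hP
    have hPi := uni_inv hP
    have ent : ∀ i j, x (lab i) (lab j) = Matrix.fromBlocks P (P * Q.submatrix id Fin.rev) 0
        P⁻¹.transpose i j := fun i j => by rw [← hx]; rfl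
    refine ⟨⟨fun i => ?_, fun i j hij => ?_⟩, ?_⟩
    · obtain ⟨i, rfl⟩ := lab.surjective i
      rw [ent]
      rcases i with i | i
      · exact hP.1 i
      · exact hPi.1 i
    · obtain ⟨i, rfl⟩ := lab.surjective i
      obtain ⟨j, rfl⟩ := lab.surjective j
      rw [ent]
      rcases i with i | i <;> rcases j with j | j
      · exact hP.2 i j ((lab_inl_lt _ _).1 hij)
      · exact absurd hij (lab_lt i j).asymm
      · rfl
      · exact hPi.2 j i ((lab_inr_lt _ _).1 hij)
    · rw [mul1, adj_lab _ _ _ _ x hx, hx, Matrix.fromBlocks_multiply, ← Matrix.fromBlocks_one]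
      rw [skew_iff] at hQ
      congr 1
      · simp [Matrix.mul_nonsing_inv P hu]
      · rw [Matrix.transpose_mul, hQ]; simp [Matrix.mul_assoc]
      · simp
      · simp [← Matrix.transpose_mul, Matrix.mul_nonsing_inv P hu]
  · rintro ⟨hU, hO⟩
    obtain ⟨A, B, C, D, hx⟩ : ∃ A B C D, x.submatrix lab lab = Matrix.fromBlocks A B C D :=
      ⟨_, _, _, _, (Matrix.fromBlocks_toBlocks _).symm⟩
    have ent : ∀ i j, x (lab i) (lab j) = Matrix.fromBlocks A B C D i j := fun i j => by
      rw [← hx]; rfl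
    have hC : C = 0 := by
      ext i j
      exact (ent (Sum.inr i) (Sum.inl j)).symm.trans (hU.2 _ _ (lab_lt j i))
    have hA : A ∈ Uni (Fin n) F :=
      ⟨fun i => (ent (Sum.inl i) (Sum.inl i)).symm.trans (hU.1 _), fun i j h =>
        (ent (Sum.inl i) (Sum.inl j)).symm.trans (hU.2 _ _ ((lab_inl_lt _ _).2 h))⟩
    have hu := uni_isUnit hA
    subst hC
    rw [mul1, adj_lab _ _ _ _ x hx, hx, Matrix.fromBlocks_multiply, ← Matrix.fromBlocks_one,
      Matrix.fromBlocks_inj] at hO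
    obtain ⟨h1, h2, -, h4⟩ := hO
    have hD : D = A⁻¹.transpose := by
      have : A * D.transpose = 1 := by simpa using h1
      rw [Matrix.inv_eq_right_inv this, Matrix.transpose_transpose]
    have hadd : A * B.transpose = -(B * A.transpose) := eq_neg_of_add_eq_zero_left h2
    have hQ' : ((A⁻¹ * B).submatrix id Fin.rev).submatrix id Fin.rev = A⁻¹ * B := by
      ext i j; simp [Matrix.submatrix]
    have hxx : x.submatrix lab lab = ((Matrix.fromBlocks A (A * (A⁻¹ * B).submatrix id Fin.rev) 0
        (antidiag n F * A⁻¹.transpose * antidiag n F)).submatrix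
        place place : Matrix (PM n) (PM n) F).submatrix lab lab := by
      rw [fromBlocks_lab, hQ', hx, hD, Matrix.mul_nonsing_inv_cancel_left _ _ hu]
    refine ⟨A, hA, (A⁻¹ * B).submatrix id Fin.rev, ?_, ?_⟩
    · rw [skew_iff, hQ']
      have hut : IsUnit A.transpose.det := by rwa [Matrix.det_transpose]
      calc (A⁻¹ * B).transpose = A⁻¹ * (A * B.transpose) * A⁻¹.transpose := by
            rw [Matrix.nonsing_inv_mul_cancel_left _ _ hu, Matrix.transpose_mul]
        _ = -(A⁻¹ * B) := by
            rw [hadd, Matrix.transpose_nonsing_inv, Matrix.mul_neg, Matrix.neg_mul,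
              ← Matrix.mul_assoc, Matrix.mul_nonsing_inv_cancel_right _ _ hut]
    · ext i j
      obtain ⟨i, rfl⟩ := lab.surjective i
      obtain ⟨j, rfl⟩ := lab.surjective j
      exact congrFun (congrFun hxx i) j

end group
end TypeD

namespace TypeD

/-! Superclasses and superclass functions. -/

section super
variable {n : ℕ} {F : Type*} [Field F]

/-- The matrix `y_λ = ∑ a e_{ij}`, summed over the arcs `(i, j, a)` of `λ`. -/
def DPartition.mat (lam : DPartition n F) : Matrix (PM n) (PM n) F :=
  ∑ t ∈ lam.arcs, Matrix.single t.1 t.2.1 t.2.2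

/-- The superclass `K_λ`: the elements `x` of the group of type D such that `x - 1` lies in the
two-sided orbit of `y_λ` under the unipotent upper triangular matrices. -/
def superclass (lam : DPartition n F) : Set (UD n F) :=
  {x | (x : Matrix (PM n) (PM n) F) - 1 ∈ orbit lam.mat}

/-- The space of superclass functions on the group of type D. -/
def SC (n : ℕ) (F : Type*) [Field F] : Submodule ℂ (UD n F → ℂ) where
  carrier := {f | ∀ lam : DPartition n F, ∀ x ∈ superclass lam, ∀ y ∈ superclass lam, f x = f y}
  add_mem' := fun {f g} hf hg lam x hx y hy => by
    rw [Pi.add_apply, Pi.add_apply, hf lam x hx y hy, hg lam x hx y hy]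
  zero_mem' := fun _ _ _ _ _ => rfl
  smul_mem' := fun c f hf lam x hx y hy => by
    rw [Pi.smul_apply, Pi.smul_apply, hf lam x hx y hy]

theorem superclass_congr (lam : DPartition n F) (x y : UD n F)
    (h : (y : Matrix (PM n) (PM n) F) - 1 ∈ orbit ((x : Matrix (PM n) (PM n) F) - 1)) :
    x ∈ superclass lam ↔ y ∈ superclass lam :=
  ⟨fun hx => orbit_trans hx h, fun hy => orbit_trans hy (orbit_symm h)⟩

theorem superclass_orbit (lam : DPartition n F) (x y : UD n F) (hx : x ∈ superclass lam)
    (hy : y ∈ superclass lam) :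
    (y : Matrix (PM n) (PM n) F) - 1 ∈ orbit ((x : Matrix (PM n) (PM n) F) - 1) :=
  orbit_trans (orbit_symm hx) hy

open Classical in
/-- The superclass characteristic function `κ_λ`. -/
def kappa (lam : DPartition n F) : SC n F :=
  ⟨fun x => if x ∈ superclass lam then 1 else 0, fun mu x hx y hy => by
    have := superclass_congr lam x y (superclass_orbit mu x y hx hy)
    simp [this]⟩

theorem mat_of_partial (y : Matrix (PM n) (PM n) F) (lam : DPartition n F)
    (h : ∀ i j a, (i, j, a) ∈ lam.arcs ↔ a ≠ 0 ∧ y i j = a) : lam.mat = y := by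
  classical
  ext i j
  rw [DPartition.mat, Matrix.sum_apply]
  by_cases h0 : y i j = 0
  · rw [h0]
    refine Finset.sum_eq_zero ?_
    rintro ⟨r, s, a⟩ ht
    rw [Matrix.single_apply]
    split_ifs with h1
    · obtain ⟨rfl, rfl⟩ := h1
      obtain ⟨h2, h3⟩ := (h _ _ _).1 ht
      exact absurd (h3.symm.trans h0) h2
    · rfl
  · rw [Finset.sum_eq_single (i, j, y i j)]
    · simp
    · rintro ⟨r, s, a⟩ ht hne
      rw [Matrix.single_apply, if_neg]
      rintro ⟨rfl, rfl⟩
      exact hne (by rw [((h _ _ _).1 ht).2])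
    · intro hn
      exact absurd ((h _ _ _).2 ⟨h0, rfl⟩) hn

theorem exists_mat [NeZero (2 : F)] (y : Matrix (PM n) (PM n) F) (hP : Partial y)
    (hsym : ∀ i j, y (opp j) (opp i) = -y i j) (hlow : ∀ i j, y i j ≠ 0 → i < j) :
    ∃ lam : DPartition n F, lam.mat = y := by
  classical
  obtain ⟨S, hmem⟩ : ∃ S : Finset (PM n × PM n × F),
      ∀ i j a, (i, j, a) ∈ S ↔ a ≠ 0 ∧ y i j = a := by
    refine ⟨((Finset.univ : Finset (PM n × PM n)).filter
      fun p => y p.1 p.2 ≠ 0).image fun p => (p.1, p.2, y p.1 p.2), fun i j a => ?_⟩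
    simp only [Finset.mem_image, Finset.mem_filter, Finset.mem_univ, true_and, Prod.mk.injEq,
      Prod.exists]
    constructor
    · rintro ⟨r, s, h1, rfl, rfl, rfl⟩
      exact ⟨h1, rfl⟩
    · rintro ⟨h1, rfl⟩
      exact ⟨i, j, h1, rfl, rfl, rfl⟩
  exact ⟨
    { arcs := S
      lt := fun i j a ha => by
        obtain ⟨h1, rfl⟩ := (hmem _ _ _).1 ha
        exact hlow i j h1
      ne_opp := fun i j a ha => by
        obtain ⟨h1, rfl⟩ := (hmem _ _ _).1 ha
        rintro rfl
        have := hsym i (opp i)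
        rw [opp_opp, eq_neg_iff_add_eq_zero, ← two_mul] at this
        exact h1 ((mul_eq_zero.1 this).resolve_left (NeZero.ne 2))
      ne_zero := fun i j a ha => ((hmem _ _ _).1 ha).1
      label := fun i j a b ha hb => ((hmem _ _ _).1 ha).2.symm.trans ((hmem _ _ _).1 hb).2
      symm := fun i j a ha => by
        obtain ⟨h1, rfl⟩ := (hmem _ _ _).1 ha
        exact (hmem _ _ _).2 ⟨neg_ne_zero.2 h1, hsym i j⟩
      short := fun i j a ha k hik hkj b => by
        obtain ⟨h1, rfl⟩ := (hmem _ _ _).1 ha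
        refine ⟨fun hb => ?_, fun hb => ?_⟩
        · obtain ⟨h2, rfl⟩ := (hmem _ _ _).1 hb
          exact hkj.ne (hP.1 i k j h2 h1)
        · obtain ⟨h2, rfl⟩ := (hmem _ _ _).1 hb
          exact hik.ne (hP.2 i k j h1 h2) }, mat_of_partial y _ hmem⟩

/-- Every element of the group of type D lies in a superclass. -/
theorem exists_superclass [NeZero (2 : F)] (x : UD n F) :
    ∃ lam : DPartition n F, x ∈ superclass lam := by
  classical
  obtain ⟨x, hxD⟩ := x
  obtain ⟨hU, hO⟩ := (mem_UD_iff x).1 hxD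
  obtain ⟨y, hy, hP⟩ := exists_partial (x - 1)
  obtain ⟨g, hg, h, hh, e⟩ := hy
  have hadj : adj (x - 1) = -(adj x * (x - 1)) := by
    have h1 : adj (x - 1) = adj x - 1 := by
      ext i j
      have := congrFun (congrFun (adj_one (n := n) (F := F)) i) j
      simp only [adj_apply, Matrix.sub_apply] at this ⊢
      rw [this]
    have h2 : adj x * x = 1 := mul_eq_one_comm.1 hO
    rw [h1, Matrix.mul_sub, h2, Matrix.mul_one]; abel
  have hneg : -adj y = (adj h * adj x) * (x - 1) * adj g := by
    rw [e, adj_mul, adj_mul, hadj]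
    simp only [Matrix.mul_assoc, Matrix.mul_neg, Matrix.neg_mul, neg_neg]
  have hor : -adj y ∈ orbit y :=
    orbit_trans (orbit_symm ⟨g, hg, h, hh, e⟩)
      ⟨_, uni_mul (adj_uni hh) (adj_uni hU), _, adj_uni hg, hneg⟩
  have hPa : Partial (-adj y) := by
    constructor
    · intro i j k hj hk
      have := hP.2 (opp j) (opp k) (opp i) (by simpa [adj_apply] using hj)
        (by simpa [adj_apply] using hk)
      rw [← opp_opp j, this, opp_opp]
    · intro i j k hj hk
      have := hP.1 (opp k) (opp i) (opp j) (by simpa [adj_apply] using hj)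
        (by simpa [adj_apply] using hk)
      rw [← opp_opp i, this, opp_opp]
  have hya : -adj y = y := partial_unique hP hPa hor
  have hsym : ∀ i j, y (opp j) (opp i) = -y i j := by
    intro i j
    have := congrFun (congrFun hya i) j
    rw [← this]; simp [adj_apply]
  have hlow : ∀ i j, y i j ≠ 0 → i < j := by
    intro i j hij
    by_contra hlt
    rw [not_lt] at hlt
    refine hij ?_
    rw [e, Matrix.mul_apply]
    refine Finset.sum_eq_zero fun k _ => ?_
    rcases lt_or_ge j k with hk | hk
    · rw [hh.2 k j hk, mul_zero]
    rw [Matrix.mul_apply, Finset.sum_eq_zero, zero_mul]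
    intro r _
    rcases lt_or_ge r i with hr | hr
    · rw [hg.2 i r hr, zero_mul]
    rcases (hk.trans (hlt.trans hr)).lt_or_eq with hkr | hkr
    · rw [Matrix.sub_apply, hU.2 r k hkr, Matrix.one_apply_ne hkr.ne']; simp
    · subst hkr; simp [hU.1]
  obtain ⟨lam, hlam⟩ := exists_mat y hP hsym hlow
  refine ⟨lam, ?_⟩
  change x - 1 ∈ orbit lam.mat
  rw [hlam]
  exact orbit_symm ⟨g, hg, h, hh, e⟩

theorem SC_congr [NeZero (2 : F)] (f : SC n F) (x y : UD n F)
    (h : (y : Matrix (PM n) (PM n) F) - 1 ∈ orbit ((x : Matrix (PM n) (PM n) F) - 1)) :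
    (f : UD n F → ℂ) x = (f : UD n F → ℂ) y := by
  obtain ⟨lam, hl⟩ := exists_superclass x
  exact f.2 lam x hl y ((superclass_congr lam x y h).1 hl)

end super

/-! Superclass functions on a product of two groups of type D. -/

section tensor
variable {k l : ℕ} {F : Type*} [Field F]

/-- The functions on a product of two groups that are constant on products of superclasses. -/
def SCProd (k l : ℕ) (F : Type*) [Field F] : Submodule ℂ (UD k F × UD l F → ℂ) where
  carrier := {f | ∀ (mu : DPartition k F) (nu : DPartition l F),
    ∀ u ∈ superclass mu, ∀ u' ∈ superclass mu, ∀ v ∈ superclass nu, ∀ v' ∈ superclass nu,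
      f (u, v) = f (u', v')}
  add_mem' := fun {f g} hf hg mu nu u hu u' hu' v hv v' hv' => by
    rw [Pi.add_apply, Pi.add_apply, hf mu nu u hu u' hu' v hv v' hv',
      hg mu nu u hu u' hu' v hv v' hv']
  zero_mem' := fun _ _ _ _ _ _ _ _ _ _ => rfl
  smul_mem' := fun c f hf mu nu u hu u' hu' v hv v' hv' => by
    rw [Pi.smul_apply, Pi.smul_apply, hf mu nu u hu u' hu' v hv v' hv']

/-- The map `α ⊗ β ↦ ((u, v) ↦ α(u) β(v))`. -/
def tensorHom (k l : ℕ) (F : Type*) [Field F] : SC k F ⊗[ℂ] SC l F →ₗ[ℂ] SCProd k l F :=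
  TensorProduct.lift (LinearMap.mk₂ ℂ
    (fun f g => ⟨fun p => (f : UD k F → ℂ) p.1 * (g : UD l F → ℂ) p.2,
      fun mu nu u hu u' hu' v hv v' hv' => by
        simp only [f.2 mu u hu u' hu', g.2 nu v hv v' hv']⟩)
    (fun f f' g => by ext p; simp [add_mul])
    (fun c f g => by ext p; simp [mul_assoc])
    (fun f g g' => by ext p; simp [mul_add])
    (fun c f g => by ext p; simp [mul_left_comm]))

theorem tensorHom_tmul (f : SC k F) (g : SC l F) (p : UD k F × UD l F) :
    (tensorHom k l F (f ⊗ₜ g) : UD k F × UD l F → ℂ) p =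
      (f : UD k F → ℂ) p.1 * (g : UD l F → ℂ) p.2 := rfl

variable [Finite F]

theorem tensorHom_injective : Function.Injective (tensorHom k l F) := by
  have : Finite (Matrix (PM k) (PM k) F) := inferInstanceAs (Finite (PM k → PM k → F))
  have : Finite (Matrix (PM l) (PM l) F) := inferInstanceAs (Finite (PM l → PM l → F))
  have : Fintype (UD l F) := Fintype.ofFinite _
  classical
  have key : ∀ (t : SC k F ⊗[ℂ] SC l F) u v,
      TensorProduct.piScalarRight ℂ ℂ (UD k F → ℂ) (UD l F)
        (TensorProduct.map (SC k F).subtype (SC l F).subtype t) v u =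
      (tensorHom k l F t : UD k F × UD l F → ℂ) (u, v) := by
    intro t u v
    induction t with
    | zero => simp
    | tmul f g => simp [tensorHom_tmul, TensorProduct.piScalarRight_apply, mul_comm]
    | add a b ha hb => simp only [map_add, Pi.add_apply, ha, hb, Submodule.coe_add]
  intro s t hst
  have hinj : Function.Injective (TensorProduct.map (SC k F).subtype (SC l F).subtype) :=
    TensorProduct.map_injective_of_flat_flat _ _ Subtype.val_injective Subtype.val_injective
  apply hinj
  apply (TensorProduct.piScalarRight ℂ ℂ (UD k F → ℂ) (UD l F)).injective
  ext v u
  rw [key, key, hst]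

theorem tensorHom_surjective [NeZero (2 : F)] : Function.Surjective (tensorHom k l F) := by
  have : Finite (Matrix (PM k) (PM k) F) := inferInstanceAs (Finite (PM k → PM k → F))
  classical
  intro f
  let S : Setoid (UD k F) :=
    { r := fun x y => (y : Matrix (PM k) (PM k) F) - 1 ∈ orbit ((x : Matrix (PM k) (PM k) F) - 1)
      iseqv := ⟨fun x => orbit_refl _, orbit_symm, orbit_trans⟩ }
  have : Fintype (Quotient S) := Fintype.ofFinite _
  let a : Quotient S → SC k F := fun c =>
    ⟨fun x => if (Quotient.mk S x) = c then 1 else 0, fun mu x hx y hy => by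
      have : Quotient.mk S x = Quotient.mk S y :=
        Quotient.sound (superclass_orbit mu x y hx hy)
      simp [this]⟩
  let b : Quotient S → SC l F := fun c =>
    ⟨fun v => (f : UD k F × UD l F → ℂ) (c.out, v), fun nu v hv v' hv' => by
      obtain ⟨mu, hmu⟩ := exists_superclass c.out
      exact f.2 mu nu _ hmu _ hmu v hv v' hv'⟩
  refine ⟨∑ c, a c ⊗ₜ b c, ?_⟩
  ext ⟨u, v⟩
  rw [map_sum, Submodule.coe_sum, Finset.sum_apply, Finset.sum_eq_single (Quotient.mk S u)]
  · rw [tensorHom_tmul]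
    simp only [a, b, if_true, one_mul]
    obtain ⟨mu, hmu⟩ := exists_superclass (Quotient.mk S u).out
    obtain ⟨nu, hnu⟩ := exists_superclass v
    have h : (u : Matrix (PM k) (PM k) F) - 1 ∈
        orbit (((Quotient.mk S u).out : Matrix (PM k) (PM k) F) - 1) :=
      Quotient.mk_out (s := S) u
    exact f.2 mu nu _ hmu _ ((superclass_congr mu _ u h).1 hmu) v hnu v hnu
  · intro c _ hc
    rw [tensorHom_tmul]
    simp only [a, if_neg hc.symm, zero_mul]
  · simp

/-- Superclass functions on a product of two groups are identified with tensors. -/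
def tensorEquiv (k l : ℕ) (F : Type*) [Field F] [Finite F] [NeZero (2 : F)] :
    SC k F ⊗[ℂ] SC l F ≃ₗ[ℂ] SCProd k l F :=
  LinearEquiv.ofBijective (tensorHom k l F) ⟨tensorHom_injective, tensorHom_surjective⟩

end tensor

/-! Restriction and coproduct. -/

section coproduct
variable {n : ℕ} {F : Type*} [Field F]

/-- The subgroup `U_J` for `J = (A | Aᶜ)`: the matrices whose `(i, j)` entry is nonzero only if
`i` and `j` both lie in `±A` or both lie in `±Aᶜ`. -/
def UJ (A : Finset (Fin n)) (F : Type*) [Field F] : Set (UD n F) :=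
  {x | ∀ i j, (x : Matrix (PM n) (PM n) F) i j ≠ 0 → (absv i ∈ A ↔ absv j ∈ A)}

theorem submatrix_mem (x : Matrix (PM n) (PM n) F) (hx : x ∈ UD n F) (B : Finset (Fin n))
    (h : ∀ i j, x i j ≠ 0 → absv i ∈ B → absv j ∈ B) :
    x.submatrix (unst B) (unst B) ∈ UD B.card F := by
  obtain ⟨hU, hO⟩ := (mem_UD_iff x).1 hx
  refine (mem_UD_iff _).2 ⟨⟨fun i => hU.1 _, fun i j hij => hU.2 _ _ ((unst_lt B _ _).2 hij)⟩, ?_⟩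
  ext i j
  have e := congrFun (congrFun hO (unst B i)) (unst B j)
  rw [Matrix.one_apply] at e ⊢
  simp only [(unst_inj B).eq_iff] at e
  rw [← e, Matrix.mul_apply, Matrix.mul_apply]
  refine Fintype.sum_of_injective (unst B) (unst_inj B) _ _ ?_ ?_
  · intro r hr
    by_contra h0
    exact hr (exists_unst B r (h _ r (left_ne_zero_of_mul h0) (absv_unst B i)))
  · intro r
    simp only [adj_apply, Matrix.submatrix_apply, unst_opp]

/-- Reordering of rows and columns, from `U_J` to the product of the smaller groups. -/
def stMap (A : Finset (Fin n)) (F : Type*) [Field F] (x : UJ A F) :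
    UD A.card F × UD Aᶜ.card F :=
  (⟨(x.1 : Matrix (PM n) (PM n) F).submatrix (unst A) (unst A),
    submatrix_mem _ x.1.2 A fun i j h => (x.2 i j h).1⟩,
   ⟨(x.1 : Matrix (PM n) (PM n) F).submatrix (unst Aᶜ) (unst Aᶜ),
    submatrix_mem _ x.1.2 Aᶜ fun i j h hi => by
      rw [Finset.mem_compl] at hi ⊢
      exact fun hj => hi ((x.2 i j h).2 hj)⟩)

/-- The block sum of two matrices along `±A` and `±Aᶜ`. -/
def blk (A : Finset (Fin n)) (u : Matrix (PM A.card) (PM A.card) F)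
    (v : Matrix (PM Aᶜ.card) (PM Aᶜ.card) F) : Matrix (PM n) (PM n) F :=
  (Matrix.fromBlocks u 0 0 v).submatrix (glue A).symm (glue A).symm

theorem blk_apply (A : Finset (Fin n)) (u : Matrix (PM A.card) (PM A.card) F)
    (v : Matrix (PM Aᶜ.card) (PM Aᶜ.card) F) (i j) :
    blk A u v (glue A i) (glue A j) = Matrix.fromBlocks u 0 0 v i j := by
  simp [blk]

theorem blk_mul (A : Finset (Fin n)) (u u' : Matrix (PM A.card) (PM A.card) F)
    (v v' : Matrix (PM Aᶜ.card) (PM Aᶜ.card) F) :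
    blk A u v * blk A u' v' = blk A (u * u') (v * v') := by
  simp [blk, Matrix.submatrix_mul_equiv, Matrix.fromBlocks_multiply]

theorem blk_one (A : Finset (Fin n)) : blk A (1 : Matrix (PM A.card) (PM A.card) F) 1 = 1 := by
  simp [blk]

theorem blk_sub (A : Finset (Fin n)) (u u' : Matrix (PM A.card) (PM A.card) F)
    (v v' : Matrix (PM Aᶜ.card) (PM Aᶜ.card) F) :
    blk A u v - blk A u' v' = blk A (u - u') (v - v') := by
  ext i j
  obtain ⟨i, rfl⟩ := (glue A).surjective i
  obtain ⟨j, rfl⟩ := (glue A).surjective j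
  rw [Matrix.sub_apply, blk_apply, blk_apply, blk_apply]
  rcases i with i | i <;> rcases j with j | j <;> simp

theorem glue_opp (A : Finset (Fin n)) (i : PM A.card ⊕ PM Aᶜ.card) :
    opp (glue A i) = glue A (Sum.map opp opp i) := by
  rcases i with i | i
  · exact (unst_opp A i).symm
  · exact (unst_opp Aᶜ i).symm

theorem blk_adj (A : Finset (Fin n)) (u : Matrix (PM A.card) (PM A.card) F)
    (v : Matrix (PM Aᶜ.card) (PM Aᶜ.card) F) : adj (blk A u v) = blk A (adj u) (adj v) := by
  ext i j
  obtain ⟨i, rfl⟩ := (glue A).surjective i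
  obtain ⟨j, rfl⟩ := (glue A).surjective j
  rw [adj_apply, glue_opp, glue_opp, blk_apply, blk_apply]
  rcases i with i | i <;> rcases j with j | j <;> simp [adj_apply]

theorem blk_uni (A : Finset (Fin n)) {u : Matrix (PM A.card) (PM A.card) F}
    {v : Matrix (PM Aᶜ.card) (PM Aᶜ.card) F} (hu : u ∈ Uni _ F) (hv : v ∈ Uni _ F) :
    blk A u v ∈ Uni (PM n) F := by
  refine ⟨fun i => ?_, fun i j hij => ?_⟩
  · obtain ⟨i, rfl⟩ := (glue A).surjective i
    rw [blk_apply]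
    rcases i with i | i
    · exact hu.1 i
    · exact hv.1 i
  · obtain ⟨i, rfl⟩ := (glue A).surjective i
    obtain ⟨j, rfl⟩ := (glue A).surjective j
    rw [blk_apply]
    rcases i with i | i <;> rcases j with j | j
    · exact hu.2 i j ((unst_lt A _ _).1 hij)
    · rfl
    · rfl
    · exact hv.2 i j ((unst_lt Aᶜ _ _).1 hij)

theorem blk_UD (A : Finset (Fin n)) {u : Matrix (PM A.card) (PM A.card) F}
    {v : Matrix (PM Aᶜ.card) (PM Aᶜ.card) F} (hu : u ∈ UD _ F) (hv : v ∈ UD _ F) :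
    blk A u v ∈ UD n F := by
  rw [mem_UD_iff] at hu hv ⊢
  exact ⟨blk_uni A hu.1 hv.1, by rw [blk_adj, blk_mul, hu.2, hv.2, blk_one]⟩

theorem eq_blk (A : Finset (Fin n)) (x : UJ A F) :
    (x.1 : Matrix (PM n) (PM n) F) = blk A (stMap A F x).1 (stMap A F x).2 := by
  have h0 : ∀ i j, ¬ (absv i ∈ A ↔ absv j ∈ A) → (x.1 : Matrix (PM n) (PM n) F) i j = 0 :=
    fun i j h => by
      by_contra h1
      exact h (x.2 i j h1)
  ext i j
  obtain ⟨i, rfl⟩ := (glue A).surjective i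
  obtain ⟨j, rfl⟩ := (glue A).surjective j
  rw [blk_apply]
  rcases i with i | i <;> rcases j with j | j
  · rfl
  · refine h0 _ _ fun h => ?_
    exact Finset.mem_compl.1 (absv_unst Aᶜ j) (h.1 (absv_unst A i))
  · refine h0 _ _ fun h => ?_
    exact Finset.mem_compl.1 (absv_unst Aᶜ i) (h.2 (absv_unst A j))
  · rfl

theorem stMap_bijective (A : Finset (Fin n)) : Function.Bijective (stMap A F) := by
  refine ⟨fun x y h => ?_, fun ⟨u, v⟩ => ?_⟩
  · apply Subtype.ext
    apply Subtype.ext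
    rw [eq_blk A x, eq_blk A y, h]
  · have hJ : (⟨blk A u v, blk_UD A u.2 v.2⟩ : UD n F) ∈ UJ A F := by
      intro i j hij
      obtain ⟨i, rfl⟩ := (glue A).surjective i
      obtain ⟨j, rfl⟩ := (glue A).surjective j
      change blk A u.1 v.1 _ _ ≠ 0 at hij
      rw [blk_apply] at hij
      rcases i with i | i <;> rcases j with j | j
      · exact iff_of_true (absv_unst A i) (absv_unst A j)
      · exact absurd rfl hij
      · exact absurd rfl hij
      · exact iff_of_false (Finset.mem_compl.1 (absv_unst Aᶜ i))
          (Finset.mem_compl.1 (absv_unst Aᶜ j))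
    refine ⟨⟨_, hJ⟩, ?_⟩
    refine Prod.ext (Subtype.ext ?_) (Subtype.ext ?_)
    · ext i j
      exact blk_apply A u.1 v.1 (Sum.inl i) (Sum.inl j)
    · ext i j
      exact blk_apply A u.1 v.1 (Sum.inr i) (Sum.inr j)

/-- The bijection `st_J` from `U_J` onto the product of two groups of type D, for
`J = (A | Aᶜ)`. -/
def stJ (A : Finset (Fin n)) (F : Type*) [Field F] : UJ A F ≃ UD A.card F × UD Aᶜ.card F :=
  Equiv.ofBijective (stMap A F) (stMap_bijective A)

theorem stJ_symm_val (A : Finset (Fin n)) (p : UD A.card F × UD Aᶜ.card F) :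
    (((stJ A F).symm p).1 : Matrix (PM n) (PM n) F) = blk A p.1 p.2 := by
  have h : stMap A F ((stJ A F).symm p) = p := (stJ A F).apply_symm_apply p
  rw [eq_blk A ((stJ A F).symm p), h]

/-- The restriction of superclass functions, `χ ↦ (u ↦ χ(st_J⁻¹(u)))`. -/
def resProd [NeZero (2 : F)] (A : Finset (Fin n)) : SC n F →ₗ[ℂ] SCProd A.card Aᶜ.card F where
  toFun χ := ⟨fun u => (χ : UD n F → ℂ) ((stJ A F).symm u).1, by
    intro mu nu u hu u' hu' v hv v' hv'
    apply SC_congr χ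
    obtain ⟨g, hg, h, hh, e⟩ := superclass_orbit mu u u' hu hu'
    obtain ⟨g', hg', h', hh', e'⟩ := superclass_orbit nu v v' hv hv'
    refine ⟨_, blk_uni A hg hg', _, blk_uni A hh hh', ?_⟩
    rw [stJ_symm_val, stJ_symm_val, ← blk_one A, blk_sub, blk_sub, blk_mul, blk_mul, ← e, ← e']⟩
  map_add' _ _ := rfl
  map_smul' _ _ := rfl

/-- The restriction map with values in the tensor product. -/
def res [Finite F] [NeZero (2 : F)] (A : Finset (Fin n)) :
    SC n F →ₗ[ℂ] SC A.card F ⊗[ℂ] SC Aᶜ.card F :=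
  (tensorEquiv A.card Aᶜ.card F).symm.toLinearMap ∘ₗ resProd A

/-- The graded vector space of superclass functions. -/
abbrev SCD (F : Type*) [Field F] := ⨁ n, SC n F

/-- The inclusion of the component of superclass functions on the `n`-th group. -/
def incl (n : ℕ) (F : Type*) [Field F] : SC n F →ₗ[ℂ] SCD F :=
  DirectSum.lof ℂ ℕ (fun n => SC n F) n

/-- The coproduct: on the `n`-th component, the sum of the restrictions over all ordered
D-set partitions `(A | Aᶜ)` of `[±n]`. -/
def coproduct (F : Type*) [Field F] [Finite F] [NeZero (2 : F)] :
    SCD F →ₗ[ℂ] SCD F ⊗[ℂ] SCD F :=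
  DirectSum.toModule ℂ ℕ _ fun n => ∑ A : Finset (Fin n),
    TensorProduct.map (incl A.card F) (incl Aᶜ.card F) ∘ₗ res A

/-- The restriction `λ|_A`: the arcs of `λ` with both ends in `±A`. -/
def DPartition.restrict (lam : DPartition n F) (A : Finset (Fin n)) : DPartition n F where
  arcs := lam.arcs.filter fun t => absv t.1 ∈ A ∧ absv t.2.1 ∈ A
  lt i j a h := lam.lt i j a (Finset.mem_filter.1 h).1
  ne_opp i j a h := lam.ne_opp i j a (Finset.mem_filter.1 h).1
  ne_zero i j a h := lam.ne_zero i j a (Finset.mem_filter.1 h).1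
  label i j a b h h' := lam.label i j a b (Finset.mem_filter.1 h).1 (Finset.mem_filter.1 h').1
  symm i j a h := by
    obtain ⟨h1, h2, h3⟩ := Finset.mem_filter.1 h
    refine Finset.mem_filter.2 ⟨lam.symm i j a h1, ?_, ?_⟩
    · simpa only [absv_opp] using h3
    · simpa only [absv_opp] using h2
  short i j a h k hik hkj b := by
    obtain ⟨h1, h2⟩ := lam.short i j a (Finset.mem_filter.1 h).1 k hik hkj b
    exact ⟨fun h => h1 (Finset.mem_filter.1 h).1, fun h => h2 (Finset.mem_filter.1 h).1⟩

/-- `λ = λ|_A ⊔ λ|_{Aᶜ}`: every arc of `λ` is an arc of one of the two restrictions. -/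
def DPartition.Splits (lam : DPartition n F) (A : Finset (Fin n)) : Prop :=
  ((lam.restrict A).arcs : Set (PM n × PM n × F)) ∪ (lam.restrict Aᶜ).arcs = lam.arcs

instance (lam : DPartition n F) : DecidablePred lam.Splits := Classical.decPred _

/-- The relabelling of arcs that is inverse to `st_A`. -/
def unstArc (A : Finset (Fin n)) (t : PM A.card × PM A.card × F) : PM n × PM n × F :=
  (unst A t.1, unst A t.2.1, t.2.2)

theorem unstArc_inj (A : Finset (Fin n)) : Function.Injective (unstArc (F := F) A) := by
  rintro ⟨i, j, a⟩ ⟨i', j', a'⟩ h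
  simp only [unstArc, Prod.mk.injEq, (unst_inj A).eq_iff] at h
  obtain ⟨rfl, rfl, rfl⟩ := h
  rfl

/-- The arcs of `[±|A|]` whose relabelling is an arc of `μ`. -/
def stArcs (mu : DPartition n F) (A : Finset (Fin n)) : Finset (PM A.card × PM A.card × F) :=
  mu.arcs.preimage (unstArc A) (unstArc_inj A).injOn

theorem mem_stArcs (mu : DPartition n F) (A : Finset (Fin n)) (i j : PM A.card) (a : F) :
    (i, j, a) ∈ stArcs mu A ↔ (unst A i, unst A j, a) ∈ mu.arcs :=
  Finset.mem_preimage

/-- The standardization `st_A(μ)` of a partition `μ` with all arcs in `±A`: the ends of the arcs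
are relabelled by the order preserving bijection from `±A` to `[±|A|]`. -/
def DPartition.st (mu : DPartition n F) (A : Finset (Fin n)) : DPartition A.card F where
  arcs := stArcs mu A
  lt i j a h := (unst_lt A i j).1 (mu.lt _ _ _ ((mem_stArcs _ _ _ _ _).1 h))
  ne_opp i j a h e := mu.ne_opp _ _ _ ((mem_stArcs _ _ _ _ _).1 h) (by rw [← unst_opp, ← e])
  ne_zero i j a h := mu.ne_zero _ _ _ ((mem_stArcs _ _ _ _ _).1 h)
  label i j a b h h' :=
    mu.label _ _ _ _ ((mem_stArcs _ _ _ _ _).1 h) ((mem_stArcs _ _ _ _ _).1 h')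
  symm i j a h := by
    have := mu.symm _ _ _ ((mem_stArcs _ _ _ _ _).1 h)
    rw [mem_stArcs]
    simpa only [unst_opp] using this
  short i j a h k hik hkj b := by
    rw [mem_stArcs, mem_stArcs]
    exact mu.short _ _ _ ((mem_stArcs _ _ _ _ _).1 h) (unst A k)
      ((unst_lt A _ _).2 hik) ((unst_lt A _ _).2 hkj) b

end coproduct
end TypeD

end

/-! Fix $A$ and let $x$ be the block sum of $u$ and $v$ along $\pm A$ and $\pm A^c$. The value of
$\mathrm{Res}_J(\kappa_\lambda)$ at $(u,v)$ records whether $x\in K_\lambda$, that is, whether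
$x-1$, the block sum of $u-1$ and $v-1$, lies in the two-sided orbit of $y_\lambda$. Every orbit
contains exactly one matrix with at most one nonzero entry in each row and column (`exists_partial`,
`partial_unique`), and condition (b) makes $y_\lambda$ such a matrix (`DPartition.partial_mat`).

The row and column operations that carry $y_\lambda$ to $x-1$ need not respect the two blocks, so
they cannot simply be cut in two. Instead $u$ and $v$ are reduced separately: by `exists_superclass`
they lie in superclasses $K_\mu$ and $K_\nu$; odd characteristic serves there to exclude arcs from
$i$ to $-i$. The block sum of $y_\mu$ and $y_\nu$ again has at most one nonzero entry per row and
column (`partial_blk`), and it lies in the orbit of $x-1$ (`blk_orbit`), because block sums of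
unipotent upper triangular matrices are unipotent upper triangular. If $x\in K_\lambda$, uniqueness
forces this block sum to be $y_\lambda$ itself. Hence no arc of $\lambda$ joins $\pm A$ to $\pm
A^c$, and the two blocks are the matrices of the standardized restrictions. Conversely, when
$\lambda$ splits, block sums of operations on the two factors put $x-1$ in the orbit of $y_\lambda$.

So each restriction is either $0$ or a product of two indicator functions (`res_kappa`), and summing
over $A$ gives the formula. -/

namespace TypeD

section
variable {n : ℕ} {F : Type*} [Field F]

/-! ### Arcs of a partition as entries of its matrix. -/

theorem DPartition.mem_arcs_iff (lam : DPartition n F) (i j : PM n) (a : F) :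
    (i, j, a) ∈ lam.arcs ↔ a ≠ 0 ∧ lam.mat i j = a := by
  classical
  -- The label of the arc from `i` to `j`, or 0 if there is none. It is well defined because an arc
  -- has one label, and it encodes absence correctly because labels are nonzero; `mat_of_partial`
  -- then identifies it with `lam.mat`.
  let y : Matrix (PM n) (PM n) F :=
    Matrix.of fun i j => if h : ∃ a, (i, j, a) ∈ lam.arcs then h.choose else 0
  have hy : ∀ i j a, (i, j, a) ∈ lam.arcs ↔ a ≠ 0 ∧ y i j = a := by
    intro i j a
    by_cases h : ∃ a, (i, j, a) ∈ lam.arcs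
    · have e : y i j = h.choose := dif_pos h
      rw [e]
      constructor
      · exact fun ha => ⟨lam.ne_zero i j a ha, lam.label i j _ _ h.choose_spec ha⟩
      · rintro ⟨-, rfl⟩
        exact h.choose_spec
    · have e : y i j = 0 := dif_neg h
      rw [e]
      exact ⟨fun ha => absurd ⟨a, ha⟩ h, fun ha => absurd ha.2.symm ha.1⟩
  rw [mat_of_partial y lam hy]
  exact hy i j a

theorem DPartition.mem_arcs_of_mat_ne_zero (lam : DPartition n F) {i j : PM n}
    (h : lam.mat i j ≠ 0) : (i, j, lam.mat i j) ∈ lam.arcs :=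
  (lam.mem_arcs_iff i j _).2 ⟨h, rfl⟩

/-- Two arcs with a common left end, or a common right end, would have different lengths, and
`short` forbids the shorter one in the presence of the longer. -/
theorem DPartition.partial_mat (lam : DPartition n F) : Partial lam.mat := by
  constructor
  · intro i j k hj hk
    have hj := lam.mem_arcs_of_mat_ne_zero hj
    have hk := lam.mem_arcs_of_mat_ne_zero hk
    rcases lt_trichotomy j k with h | h | h
    · exact absurd hj (lam.short i k _ hk j (lam.lt _ _ _ hj) h _).1
    · exact h
    · exact absurd hk (lam.short i j _ hj k (lam.lt _ _ _ hk) h _).1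
  · intro i j k hi hj
    have hi := lam.mem_arcs_of_mat_ne_zero hi
    have hj := lam.mem_arcs_of_mat_ne_zero hj
    rcases lt_trichotomy i j with h | h | h
    · exact absurd hj (lam.short i k _ hi j h (lam.lt _ _ _ hj) _).2
    · exact h
    · exact absurd hi (lam.short j k _ hj i h (lam.lt _ _ _ hi) _).2

/-- The image of `unst A` is `±A`, so the filter defining the restriction imposes nothing on
relabelled arcs. No splitting hypothesis is needed: arcs leaving `±A` are lost on both sides. -/
theorem DPartition.mat_st_restrict (lam : DPartition n F) (A : Finset (Fin n)) :
    ((lam.restrict A).st A).mat = lam.mat.submatrix (unst A) (unst A) := by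
  refine mat_of_partial _ _ fun i j a => ?_
  change (i, j, a) ∈ stArcs (lam.restrict A) A ↔ _
  rw [mem_stArcs, Matrix.submatrix_apply, ← lam.mem_arcs_iff]
  exact Finset.mem_filter.trans
    (and_iff_left ⟨absv_unst A i, absv_unst A j⟩)

/-! ### Block sums: support, normal form and orbits. -/

theorem blk_injective (A : Finset (Fin n)) {u u' : Matrix (PM A.card) (PM A.card) F}
    {v v' : Matrix (PM Aᶜ.card) (PM Aᶜ.card) F} (h : blk A u v = blk A u' v') :
    u = u' ∧ v = v' := by
  have e : ∀ i j, Matrix.fromBlocks u 0 0 v i j = Matrix.fromBlocks u' 0 0 v' i j := by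
    intro i j
    rw [← blk_apply, h, blk_apply]
  exact ⟨Matrix.ext fun i j => e (Sum.inl i) (Sum.inl j),
    Matrix.ext fun i j => e (Sum.inr i) (Sum.inr j)⟩

theorem blk_ne_zero (A : Finset (Fin n)) {u : Matrix (PM A.card) (PM A.card) F}
    {v : Matrix (PM Aᶜ.card) (PM Aᶜ.card) F} {i j : PM n} (h : blk A u v i j ≠ 0) :
    absv i ∈ A ↔ absv j ∈ A := by
  obtain ⟨i, rfl⟩ := (glue A).surjective i
  obtain ⟨j, rfl⟩ := (glue A).surjective j
  rw [blk_apply] at h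
  rcases i with i | i <;> rcases j with j | j
  · exact iff_of_true (absv_unst A i) (absv_unst A j)
  · exact absurd rfl h
  · exact absurd rfl h
  · exact iff_of_false (Finset.mem_compl.1 (absv_unst Aᶜ i)) (Finset.mem_compl.1 (absv_unst Aᶜ j))

/-- The support condition says that the off-diagonal blocks vanish. Unlike `eq_blk`, this does not
ask for a group element, so it applies to `lam.mat`; `blk_ne_zero` is the converse. -/
theorem eq_blk_submatrix (A : Finset (Fin n)) (y : Matrix (PM n) (PM n) F)
    (h : ∀ i j, y i j ≠ 0 → (absv i ∈ A ↔ absv j ∈ A)) :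
    y = blk A (y.submatrix (unst A) (unst A)) (y.submatrix (unst Aᶜ) (unst Aᶜ)) := by
  ext i j
  obtain ⟨i, rfl⟩ := (glue A).surjective i
  obtain ⟨j, rfl⟩ := (glue A).surjective j
  rw [blk_apply]
  rcases i with i | i <;> rcases j with j | j
  · rfl
  · by_contra h0
    exact Finset.mem_compl.1 (absv_unst Aᶜ j) ((h _ _ h0).1 (absv_unst A i))
  · by_contra h0
    exact Finset.mem_compl.1 (absv_unst Aᶜ i) ((h _ _ h0).2 (absv_unst A j))
  · rfl

/-- A row or column of a block sum is a row or column of one summand, padded with zeros. -/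
theorem partial_blk (A : Finset (Fin n)) {u : Matrix (PM A.card) (PM A.card) F}
    {v : Matrix (PM Aᶜ.card) (PM Aᶜ.card) F} (hu : Partial u) (hv : Partial v) :
    Partial (blk A u v) := by
  constructor
  · intro i j k hj hk
    obtain ⟨i, rfl⟩ := (glue A).surjective i
    obtain ⟨j, rfl⟩ := (glue A).surjective j
    obtain ⟨k, rfl⟩ := (glue A).surjective k
    rw [blk_apply] at hj hk
    -- If the three indices do not lie in the same block, one of the two entries belongs to an
    -- off-diagonal block and is 0 by definition; the other two cases are the hypotheses on `u` and
    -- `v`.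
    rcases i with i | i <;> rcases j with j | j <;> rcases k with k | k <;>
      first
      | exact absurd rfl hj
      | exact absurd rfl hk
      | exact congrArg (glue A ∘ Sum.inl) (hu.1 i j k hj hk)
      | exact congrArg (glue A ∘ Sum.inr) (hv.1 i j k hj hk)
  · intro i j k hi hj
    obtain ⟨i, rfl⟩ := (glue A).surjective i
    obtain ⟨j, rfl⟩ := (glue A).surjective j
    obtain ⟨k, rfl⟩ := (glue A).surjective k
    rw [blk_apply] at hi hj
    rcases i with i | i <;> rcases j with j | j <;> rcases k with k | k <;>
      first
      | exact absurd rfl hi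
      | exact absurd rfl hj
      | exact congrArg (glue A ∘ Sum.inl) (hu.2 i j k hi hj)
      | exact congrArg (glue A ∘ Sum.inr) (hv.2 i j k hi hj)

/-- Block sums multiply blockwise, so the operations on the two blocks can be carried out
simultaneously. -/
theorem blk_orbit (A : Finset (Fin n)) {u u' : Matrix (PM A.card) (PM A.card) F}
    {v v' : Matrix (PM Aᶜ.card) (PM Aᶜ.card) F} (hu : u' ∈ orbit u) (hv : v' ∈ orbit v) :
    blk A u' v' ∈ orbit (blk A u v) := by
  obtain ⟨g, hg, h, hh, rfl⟩ := hu
  obtain ⟨g', hg', h', hh', rfl⟩ := hv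
  exact ⟨_, blk_uni A hg hg', _, blk_uni A hh hh', by rw [blk_mul, blk_mul]⟩

/-! ### Splitting of partitions and membership in superclasses. -/

/-- The arcs missing from both restrictions are exactly those with one end in `±A` and the other in
`±Aᶜ`. This puts splitting in the form of the support condition for block sums. -/
theorem DPartition.splits_iff (lam : DPartition n F) (A : Finset (Fin n)) :
    lam.Splits A ↔ ∀ i j, lam.mat i j ≠ 0 → (absv i ∈ A ↔ absv j ∈ A) := by
  unfold DPartition.Splits DPartition.restrict
  constructor
  · intro h i j hij
    have hm := lam.mem_arcs_of_mat_ne_zero hij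
    rw [← Finset.mem_coe, ← h] at hm
    rcases hm with hm | hm
    · exact iff_of_true (Finset.mem_filter.1 hm).2.1 (Finset.mem_filter.1 hm).2.2
    · exact iff_of_false (Finset.mem_compl.1 (Finset.mem_filter.1 hm).2.1)
        (Finset.mem_compl.1 (Finset.mem_filter.1 hm).2.2)
  · intro h
    refine Set.Subset.antisymm (Set.union_subset (fun t ht => (Finset.mem_filter.1 ht).1)
      fun t ht => (Finset.mem_filter.1 ht).1) ?_
    rintro ⟨i, j, a⟩ ht
    have hA := h i j (by
      obtain ⟨h1, h2⟩ := (lam.mem_arcs_iff i j a).1 ht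
      rwa [h2])
    by_cases hi : absv i ∈ A
    · exact Or.inl (Finset.mem_filter.2 ⟨ht, hi, hA.1 hi⟩)
    · exact Or.inr (Finset.mem_filter.2 ⟨ht, Finset.mem_compl.2 hi,
        Finset.mem_compl.2 fun hj => hi (hA.2 hj)⟩)

/-- A block sum lies in the superclass of `λ` exactly when `λ` splits along `(A | Aᶜ)` and the
blocks lie in the superclasses of the standardized restrictions. -/
theorem stJ_symm_mem_superclass_iff [NeZero (2 : F)] (lam : DPartition n F) (A : Finset (Fin n))
    (p : UD A.card F × UD Aᶜ.card F) :
    ((stJ A F).symm p).1 ∈ superclass lam ↔ lam.Splits A ∧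
      p.1 ∈ superclass ((lam.restrict A).st A) ∧
      p.2 ∈ superclass ((lam.restrict Aᶜ).st Aᶜ) := by
  have hsub : (((stJ A F).symm p).1 : Matrix (PM n) (PM n) F) - 1 =
      blk A ((p.1 : Matrix _ _ F) - 1) ((p.2 : Matrix _ _ F) - 1) := by
    rw [stJ_symm_val, ← blk_one A, blk_sub]
  change _ - 1 ∈ orbit lam.mat ↔ _ ∧ _ - 1 ∈ orbit _ ∧ _ - 1 ∈ orbit _
  rw [hsub, lam.mat_st_restrict, lam.mat_st_restrict]
  constructor
  · intro h
    -- The orbit witnesses in `h` may mix the blocks, so each block gets its own normal form, to be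
    -- compared with `lam.mat` afterwards.
    obtain ⟨mu, hmu⟩ := exists_superclass p.1
    obtain ⟨nu, hnu⟩ := exists_superclass p.2
    have e : blk A mu.mat nu.mat = lam.mat :=
      partial_unique lam.partial_mat (partial_blk A mu.partial_mat nu.partial_mat)
        (orbit_trans h (orbit_symm (blk_orbit A hmu hnu)))
    have hs : ∀ i j, lam.mat i j ≠ 0 → (absv i ∈ A ↔ absv j ∈ A) := by
      rw [← e]
      exact fun i j => blk_ne_zero A
    -- Two block decompositions of `lam.mat`: one into `mu.mat` and `nu.mat`, the other into its own
    -- diagonal submatrices.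
    obtain ⟨e1, e2⟩ := blk_injective A (e.trans (eq_blk_submatrix A lam.mat hs))
    refine ⟨(lam.splits_iff A).2 hs, ?_, ?_⟩
    · rw [← e1]; exact hmu
    · rw [← e2]; exact hnu
  · rintro ⟨hs, h1, h2⟩
    rw [eq_blk_submatrix A lam.mat ((lam.splits_iff A).1 hs)]
    exact blk_orbit A h1 h2

/-! ### Restriction and coproduct of the characteristic functions. -/

theorem kappa_apply (lam : DPartition n F) (x : UD n F) [Decidable (x ∈ superclass lam)] :
    (kappa lam : UD n F → ℂ) x = if x ∈ superclass lam then 1 else 0 := by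
  simp only [kappa]
  congr

theorem tensorEquiv_apply [Finite F] [NeZero (2 : F)] (k l : ℕ) (t : SC k F ⊗[ℂ] SC l F) :
    tensorEquiv k l F t = tensorHom k l F t := rfl

theorem res_kappa [Finite F] [NeZero (2 : F)] (lam : DPartition n F) (A : Finset (Fin n)) :
    res A (kappa lam) = if lam.Splits A then
      kappa ((lam.restrict A).st A) ⊗ₜ[ℂ] kappa ((lam.restrict Aᶜ).st Aᶜ) else 0 := by
  classical
  have key : ∀ p, (resProd A (kappa lam) : UD A.card F × UD Aᶜ.card F → ℂ) p =
      if lam.Splits A ∧ p.1 ∈ superclass ((lam.restrict A).st A) ∧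
        p.2 ∈ superclass ((lam.restrict Aᶜ).st Aᶜ) then 1 else 0 := by
    intro p
    change (kappa lam : UD n F → ℂ) ((stJ A F).symm p).1 = _
    rw [kappa_apply]
    simp only [stJ_symm_mem_superclass_iff]
  -- Moving the identification of tensors with functions to the other side leaves an equality of
  -- functions on the product of the two groups.
  rw [res, LinearMap.comp_apply, LinearEquiv.coe_coe, LinearEquiv.symm_apply_eq,
    tensorEquiv_apply]
  apply Subtype.ext
  funext p
  rw [key]
  by_cases hs : lam.Splits A
  -- The product of two indicators is the indicator of the conjunction.
  · rw [if_pos hs, tensorHom_tmul, kappa_apply, kappa_apply, ite_zero_mul_ite_zero, mul_one]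
    simp only [hs, true_and]
  · rw [if_neg hs, LinearMap.map_zero, if_neg fun h => hs h.1]
    rfl

end
end TypeD

theorem mainTheorem3 {F : Type*} [Field F] [Finite F] [NeZero (2 : F)] (n : ℕ)
    (lam : TypeD.DPartition n F) :
    TypeD.coproduct F (TypeD.incl n F (TypeD.kappa lam)) =
      ∑ A : Finset (Fin n) with lam.Splits A,
        TypeD.incl A.card F (TypeD.kappa ((lam.restrict A).st A)) ⊗ₜ[ℂ]
          TypeD.incl Aᶜ.card F (TypeD.kappa ((lam.restrict Aᶜ).st Aᶜ)) := by
  -- `Finset.sum_filter` turns the right side into a sum over all `A`, with 0 for those along which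
  -- `lam` does not split, so that the two sums match term by term.
  rw [TypeD.coproduct, TypeD.incl, DirectSum.toModule_lof, LinearMap.sum_apply, Finset.sum_filter]
  refine Finset.sum_congr rfl fun A _ => ?_
  rw [LinearMap.comp_apply, TypeD.res_kappa]
  split_ifs
  · rw [TensorProduct.map_tmul]
  · rw [map_zero]
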